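/- Let $K$ be an algebraically closed field and let $A$ be a finitely generated (associative, unital, not necessarily commutative) $K$-algebra. For $n\ge 0$ let $\mathrm{rep}_n A$ be the affine $K$-scheme representing the functor $C\mapsto \mathrm{Hom}_{K\text{-alg}}(A,M_n(C))$ on commutative $K$-algebras; its $K$-points are identified with the left $A$-modules with underlying space $K^n$. A dimension vector $\gamma$ of total dimension $|\gamma|=n$ is a connected component $\mathrm{rep}_\gamma A$ of $\mathrm{rep}_n A$, regarded as an open subscheme (not with its reduced structure). Write $M\in\mathrm{rep}_\gamma A$ if $M$ is a $K$-point of $\mathrm{rep}_\gamma A$. Let $\mathrm{comp}(A)$ be the set of all dimension vectors, with addition: $\alpha+\beta$ is the unique dimension vector $\gamma$ of total dimension $|\alpha|+|\beta|$ such that $M\oplus N\in\mathrm{rep}_\gamma A$ for all $M\in\mathrm{rep}_\alpha A$ and $N\in\mathrm{rep}_\beta A$. For finite dimensional left $A$-modules $M,N$ the spaces $\mathrm{Hom}_A(M,N)$ and $\mathrm{Ext}^1_A(M,N)$ are finite dimensional over $K$, and we put $$\chi_A(M,N)=\dim_K\mathrm{Hom}_A(M,N)-\dim_K\mathrm{Ext}^1_A(M,N).$$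 (1) If $\mathrm{rep}_\gamma A$ is smooth over $K$, then for all $M\in\mathrm{rep}_\gamma A$ $$|\gamma|^2-\chi_A(M,M)=\dim\mathrm{rep}_\gamma A,$$ and hence $\chi_A(M,M)$ is constant on $\mathrm{rep}_\gamma A$. (2) If $\mathrm{rep}_\alpha A$, $\mathrm{rep}_\beta A$ and $\mathrm{rep}_{\alpha+\beta}A$ are smooth over $K$, then $\chi_A(M,N)+\chi_A(N,M)$ is constant for $(M,N)\in\mathrm{rep}_\alpha A\times\mathrm{rep}_\beta A$. (3) Suppose that $A$ is a $K$-qurve, that is, for every $K$-algebra $B$ and every nilpotent two-sided ideal $I$ of $B$, each $K$-algebra homomorphism $A\to B/I$ lifts to a $K$-algebra homomorphism $A\to B$. Then $\mathrm{rep}_\alpha A$ is smooth over $K$ for every $\alpha\in\mathrm{comp}(A)$, and there is a symmetric form $(-,-)_A:\mathrm{comp}(A)\times\mathrm{comp}(A)\to\mathbb Z$, additive in each variable, such that $(\alpha,\beta)_A=\chi_A(M,N)+\chi_A(N,M)$ for all $M\in\mathrm{rep}_\alpha A$ and $N\in\mathrm{rep}_\beta A$. -/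

import Mathlib

universe u

namespace NCRep

/-! ## Representation schemes -/

section RepScheme

variable (K A : Type u) [Field K] [Ring A] [Algebra K A]

/-- The polynomial ring in the matrix entries `x_{ij}(a)` of a generic `n`-dimensional
representation, one variable for every `a ∈ A` and every `1 ≤ i, j ≤ n`. -/
abbrev Poly (n : ℕ) : Type u := MvPolynomial (A × Fin n × Fin n) K

/-- The matrix `X(a) = (x_{ij}(a))` of variables. -/
noncomputable def varMatrix (n : ℕ) (a : A) : Matrix (Fin n) (Fin n) (Poly K A n) :=
  fun i j => MvPolynomial.X (a, i, j)

/-- The relations saying that `a ↦ X(a)` is a homomorphism of unital `K`-algebras: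
the entries of `X(a + b) - X(a) - X(b)`, `X(ab) - X(a) X(b)` and `X(c · 1) - c · 1`. -/
inductive IsRel (n : ℕ) : Poly K A n → Prop
  | add (a b : A) (i j : Fin n) :
      IsRel n ((varMatrix K A n (a + b) - (varMatrix K A n a + varMatrix K A n b)) i j)
  | mul (a b : A) (i j : Fin n) :
      IsRel n ((varMatrix K A n (a * b) - varMatrix K A n a * varMatrix K A n b) i j)
  | scalar (c : K) (i j : Fin n) :
      IsRel n ((varMatrix K A n (algebraMap K A c)
        - algebraMap K (Matrix (Fin n) (Fin n) (Poly K A n)) c) i j)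

/-- The ideal generated by the relations. -/
noncomputable def relIdeal (n : ℕ) : Ideal (Poly K A n) := Ideal.span {p | IsRel K A n p}

/-- The coordinate ring of the affine scheme `rep_n A`. It represents the functor
`C ↦ Hom_{K-alg}(A, M_n(C))` on commutative `K`-algebras, see `repEquiv`. -/
abbrev RepRing (n : ℕ) : Type u := Poly K A n ⧸ relIdeal K A n

variable {K A}

theorem mk_rel {n : ℕ} {p : Poly K A n} (h : IsRel K A n p) :
    Ideal.Quotient.mkₐ K (relIdeal K A n) p = 0 :=
  Ideal.Quotient.eq_zero_iff_mem.mpr (Ideal.subset_span h)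

variable (K A) in
/-- The universal `n`-dimensional representation. -/
noncomputable def univRep (n : ℕ) : A →ₐ[K] Matrix (Fin n) (Fin n) (RepRing K A n) :=
  let q := (Ideal.Quotient.mkₐ K (relIdeal K A n)).mapMatrix (m := Fin n)
  have hs (c : K) : q (varMatrix K A n (algebraMap K A c)) = algebraMap K _ c := by
    rw [← q.commutes c, ← sub_eq_zero, ← map_sub]
    ext i j
    exact mk_rel (IsRel.scalar c i j)
  have ha (a b : A) : q (varMatrix K A n (a + b))
      = q (varMatrix K A n a) + q (varMatrix K A n b) := by
    rw [← map_add, ← sub_eq_zero, ← map_sub]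
    ext i j
    exact mk_rel (IsRel.add a b i j)
  { toFun := fun a => q (varMatrix K A n a)
    map_one' := by simpa using hs 1
    map_zero' := by simpa using hs 0
    map_add' := ha
    map_mul' := fun a b => by
      rw [← map_mul, ← sub_eq_zero, ← map_sub]
      ext i j
      exact mk_rel (IsRel.mul a b i j)
    commutes' := hs }

variable {C D : Type*} [CommRing C] [Algebra K C] [CommRing D] [Algebra K D]

/-- The map `K[x_{ij}(a)] → C` given by a representation of `A` over `C`. -/
noncomputable def evalPoly {n : ℕ} (ρ : A →ₐ[K] Matrix (Fin n) (Fin n) C) : Poly K A n →ₐ[K] C :=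
  MvPolynomial.aeval fun t => ρ t.1 t.2.1 t.2.2

theorem evalPoly_varMatrix {n : ℕ} (ρ : A →ₐ[K] Matrix (Fin n) (Fin n) C) (a : A) :
    (evalPoly ρ).mapMatrix (varMatrix K A n a) = ρ a := by
  ext i j
  simp [evalPoly, varMatrix]

theorem evalPoly_rel {n : ℕ} (ρ : A →ₐ[K] Matrix (Fin n) (Fin n) C) {p : Poly K A n}
    (hp : p ∈ relIdeal K A n) : evalPoly ρ p = 0 := by
  refine (Ideal.span_le (I := RingHom.ker (evalPoly ρ))).mpr ?_ hp
  have key (M : Matrix (Fin n) (Fin n) (Poly K A n)) (h : (evalPoly ρ).mapMatrix M = 0)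
      (i j : Fin n) : evalPoly ρ (M i j) = 0 := congrFun (congrFun h i) j
  rintro _ (⟨a, b, i, j⟩ | ⟨a, b, i, j⟩ | ⟨c, i, j⟩) <;> refine key _ ?_ i j
  · rw [map_sub, map_add]
    simp only [evalPoly_varMatrix, map_add, sub_self]
  · rw [map_sub, map_mul]
    simp only [evalPoly_varMatrix, map_mul, sub_self]
  · rw [map_sub, AlgHom.commutes]
    simp only [evalPoly_varMatrix, AlgHom.commutes, sub_self]

/-- The `C`-point of `rep_n A` given by a representation of `A` over `C`. -/
noncomputable def classify {n : ℕ} (ρ : A →ₐ[K] Matrix (Fin n) (Fin n) C) : RepRing K A n →ₐ[K] C :=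
  Ideal.Quotient.liftₐ (relIdeal K A n) (evalPoly ρ) fun _ hp => evalPoly_rel ρ hp

theorem classify_univRep {n : ℕ} (ρ : A →ₐ[K] Matrix (Fin n) (Fin n) C) (a : A) (i j : Fin n) :
    classify ρ (univRep K A n a i j) = ρ a i j :=
  congrFun (congrFun (evalPoly_varMatrix ρ a) i) j

theorem repRing_hom_ext {n : ℕ} {f g : RepRing K A n →ₐ[K] C}
    (h : ∀ a i j, f (univRep K A n a i j) = g (univRep K A n a i j)) : f = g := by
  refine Ideal.Quotient.algHom_ext K (MvPolynomial.algHom_ext ?_)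
  rintro ⟨a, i, j⟩
  exact h a i j

/-- The universal property of `RepRing K A n`. -/
noncomputable def repEquiv (n : ℕ) (C : Type*) [CommRing C] [Algebra K C] :
    (A →ₐ[K] Matrix (Fin n) (Fin n) C) ≃ (RepRing K A n →ₐ[K] C) where
  toFun := classify
  invFun f := f.mapMatrix.comp (univRep K A n)
  left_inv ρ := by
    ext a i j
    exact classify_univRep ρ a i j
  right_inv f := repRing_hom_ext fun a i j => classify_univRep _ a i j

theorem classify_comp {n : ℕ} (f : C →ₐ[K] D) (ρ : A →ₐ[K] Matrix (Fin n) (Fin n) C) :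
    classify (f.mapMatrix.comp ρ) = f.comp (classify ρ) :=
  repRing_hom_ext fun a i j => by
    rw [AlgHom.comp_apply, classify_univRep, classify_univRep]
    rfl

/-- The direct sum of two representations, as a block diagonal matrix. -/
noncomputable def dirSum {n m : ℕ} (ρ : A →ₐ[K] Matrix (Fin n) (Fin n) C)
    (σ : A →ₐ[K] Matrix (Fin m) (Fin m) C) :
    A →ₐ[K] Matrix (Fin (n + m)) (Fin (n + m)) C :=
  (Matrix.reindexAlgEquiv K C finSumFinEquiv).toAlgHom.comp
    { toFun := fun a => Matrix.fromBlocks (ρ a) 0 0 (σ a)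
      map_one' := by simp
      map_zero' := by simp
      map_add' := fun a b => by simp [Matrix.fromBlocks_add]
      map_mul' := fun a b => by simp [Matrix.fromBlocks_multiply]
      commutes' := fun c => by
        ext (i | i) (j | j) <;>
          simp [Matrix.algebraMap_eq_diagonal, Matrix.diagonal_apply] }

theorem dirSum_map {n m : ℕ} (f : C →ₐ[K] D) (ρ : A →ₐ[K] Matrix (Fin n) (Fin n) C)
    (σ : A →ₐ[K] Matrix (Fin m) (Fin m) C) :
    f.mapMatrix.comp (dirSum ρ σ) = dirSum (f.mapMatrix.comp ρ) (f.mapMatrix.comp σ) := by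
  ext a i j
  simp only [dirSum, AlgHom.comp_apply, AlgHom.mapMatrix_apply, Matrix.map_apply]
  change f (Matrix.fromBlocks _ _ _ _ _ _) = Matrix.fromBlocks _ _ _ _ _ _
  generalize finSumFinEquiv.symm i = i'
  generalize finSumFinEquiv.symm j = j'
  rcases i' with i' | i' <;> rcases j' with j' | j' <;> simp

end RepScheme

/-! ## The component semigroup -/

section Components

variable (K A : Type u) [Field K] [Ring A] [Algebra K A]

/-- The dimension vectors of `A`: a dimension vector `γ` consists of a total dimension `|γ|` and a
connected component of the scheme `rep_{|γ|} A`. -/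
structure Comp : Type u where
  /-- The total dimension `|γ|`. -/
  dim : ℕ
  /-- The connected component. -/
  comp : ConnectedComponents (PrimeSpectrum (RepRing K A dim))

variable {K A}

/-- The underlying set of the component `rep_γ A` of `rep_n A`, where `n = |γ|`. -/
def Comp.carrier (γ : Comp K A) : Set (PrimeSpectrum (RepRing K A γ.dim)) :=
  {p | ConnectedComponents.mk p = γ.comp}

/-- The scheme `rep_γ A` is smooth over `K`: the scheme `rep_n A`, of which it is an open subscheme
when `A` is finitely generated, is smooth over `K` at every point of `rep_γ A`. -/
def Comp.IsSmooth (γ : Comp K A) : Prop :=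
  γ.carrier ⊆ Algebra.smoothLocus K (RepRing K A γ.dim)

variable (K A) in
/-- The `K`-points of `rep_n A`. -/
abbrev Rep (n : ℕ) : Type u := A →ₐ[K] Matrix (Fin n) (Fin n) K

/-- The point of the spectrum given by a `K`-point. -/
noncomputable def Rep.point {n : ℕ} (M : Rep K A n) : PrimeSpectrum (RepRing K A n) :=
  ⟨RingHom.ker (classify M), RingHom.ker_isPrime _⟩

/-- The `K`-point `M` of `rep_n A` lies in the component `rep_γ A`. -/
def Comp.Mem (γ : Comp K A) (M : Rep K A γ.dim) : Prop := Rep.point M ∈ γ.carrier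

/-- Varying the first summand inside its component does not change the component of the sum. -/
theorem dirSum_left {n m : ℕ} {M M' : Rep K A n} (N : Rep K A m)
    (h : ConnectedComponents.mk (Rep.point M) = ConnectedComponents.mk (Rep.point M')) :
    ConnectedComponents.mk (Rep.point (dirSum M N))
      = ConnectedComponents.mk (Rep.point (dirSum M' N)) := by
  let R := RepRing K A n
  let φ : RepRing K A (n + m) →ₐ[K] R :=
    classify (dirSum (univRep K A n) ((Algebra.ofId K R).mapMatrix.comp N))
  have key (L : Rep K A n) : PrimeSpectrum.comap φ.toRingHom (Rep.point L)
      = Rep.point (dirSum L N) := by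
    have e : (classify L).comp φ = classify (dirSum L N) := by
      rw [← classify_comp, dirSum_map]
      congr 2
      · ext a i j
        exact classify_univRep L a i j
      · ext a i j
        exact (classify L).commutes _
    ext x
    change classify L (φ x) = 0 ↔ classify (dirSum L N) x = 0
    rw [← e]
    rfl
  rw [ConnectedComponents.coe_eq_coe'] at h
  rw [ConnectedComponents.coe_eq_coe', ← key, ← key]
  exact (PrimeSpectrum.continuous_comap φ.toRingHom).image_connectedComponent_subset _ ⟨_, h, rfl⟩

/-- Varying the second summand inside its component does not change the component of the sum. -/
theorem dirSum_right {n m : ℕ} (M : Rep K A n) {N N' : Rep K A m}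
    (h : ConnectedComponents.mk (Rep.point N) = ConnectedComponents.mk (Rep.point N')) :
    ConnectedComponents.mk (Rep.point (dirSum M N))
      = ConnectedComponents.mk (Rep.point (dirSum M N')) := by
  let R := RepRing K A m
  let φ : RepRing K A (n + m) →ₐ[K] R :=
    classify (dirSum ((Algebra.ofId K R).mapMatrix.comp M) (univRep K A m))
  have key (L : Rep K A m) : PrimeSpectrum.comap φ.toRingHom (Rep.point L)
      = Rep.point (dirSum M L) := by
    have e : (classify L).comp φ = classify (dirSum M L) := by
      rw [← classify_comp, dirSum_map]
      congr 2
      · ext a i j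
        exact (classify L).commutes _
      · ext a i j
        exact classify_univRep L a i j
    ext x
    change classify L (φ x) = 0 ↔ classify (dirSum M L) x = 0
    rw [← e]
    rfl
  rw [ConnectedComponents.coe_eq_coe'] at h
  rw [ConnectedComponents.coe_eq_coe', ← key, ← key]
  exact (PrimeSpectrum.continuous_comap φ.toRingHom).image_connectedComponent_subset _ ⟨_, h, rfl⟩

instance [Algebra.FiniteType K A] (n : ℕ) : Algebra.FiniteType K (RepRing K A n) := by
  obtain ⟨S, hS⟩ := (inferInstance : Algebra.FiniteType K A).out
  classical
  let T : Set (RepRing K A n) :=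
    Set.range fun t : S × Fin n × Fin n => univRep K A n t.1 t.2.1 t.2.2
  have hT : ∀ a i j, univRep K A n a i j ∈ Algebra.adjoin K T := by
    intro a
    have ha : a ∈ Algebra.adjoin K (S : Set A) := hS ▸ Algebra.mem_top
    induction ha using Algebra.adjoin_induction with
    | mem x hx => exact fun i j => Algebra.subset_adjoin ⟨(⟨x, hx⟩, i, j), rfl⟩
    | algebraMap c =>
      intro i j
      rw [AlgHom.commutes, Matrix.algebraMap_matrix_apply]
      split_ifs
      · exact Subalgebra.algebraMap_mem _ c
      · exact zero_mem _
    | add x y _ _ hx hy =>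
      intro i j
      rw [map_add]
      exact add_mem (hx i j) (hy i j)
    | mul x y _ _ hx hy =>
      intro i j
      rw [map_mul, Matrix.mul_apply]
      exact sum_mem fun k _ => mul_mem (hx i k) (hy k j)
  refine ⟨⟨(Set.finite_range fun t : S × Fin n × Fin n =>
    univRep K A n t.1 t.2.1 t.2.2).toFinset, ?_⟩⟩
  rw [Set.Finite.coe_toFinset]
  refine top_unique fun x _ => ?_
  obtain ⟨p, rfl⟩ := Ideal.Quotient.mk_surjective x
  induction p using MvPolynomial.induction_on with
  | C c => exact Subalgebra.algebraMap_mem _ c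
  | add p q hp hq =>
    rw [map_add]
    exact add_mem (hp trivial) (hq trivial)
  | mul_X p t hp =>
    rw [map_mul]
    exact mul_mem (hp trivial) (hT t.1 t.2.1 t.2.2)

/-- Every component contains a `K`-point. -/
theorem Comp.exists_mem [IsAlgClosed K] [Algebra.FiniteType K A] (γ : Comp K A) :
    ∃ M : Rep K A γ.dim, γ.Mem M := by
  obtain ⟨n, c⟩ := γ
  obtain ⟨p, rfl⟩ := ConnectedComponents.surjective_coe c
  obtain ⟨m, hm, hpm⟩ := Ideal.exists_le_maximal p.asIdeal p.isPrime.ne_top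
  let R := RepRing K A n
  let _ : Field (R ⧸ m) := Ideal.Quotient.field m
  have : Module.Finite K (R ⧸ m) := finite_of_finite_type_of_isJacobsonRing K (R ⧸ m)
  let e : K ≃ₐ[K] R ⧸ m :=
    AlgEquiv.ofBijective (Algebra.ofId K (R ⧸ m))
      (IsAlgClosed.algebraMap_bijective_of_isIntegral (k := K) (K := R ⧸ m))
  let f : R →ₐ[K] K := e.symm.toAlgHom.comp (Ideal.Quotient.mkₐ K m)
  have hf : classify ((repEquiv n K).symm f) = f := (repEquiv n K).apply_symm_apply f
  refine ⟨(repEquiv n K).symm f, ?_⟩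
  have hpt : Rep.point ((repEquiv n K).symm f) = ⟨m, hm.isPrime⟩ := by
    ext x
    change classify ((repEquiv n K).symm f) x = 0 ↔ x ∈ m
    rw [hf]
    change e.symm (Ideal.Quotient.mk m x) = 0 ↔ _
    rw [map_eq_zero_iff _ e.symm.injective, Ideal.Quotient.eq_zero_iff_mem]
  change ConnectedComponents.mk _ = ConnectedComponents.mk p
  rw [hpt, ConnectedComponents.coe_eq_coe']
  refine isClosed_connectedComponent.closure_subset_iff.mpr
    (Set.singleton_subset_iff.mpr (mem_connectedComponent (x := p))) ?_
  rw [← specializes_iff_mem_closure]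
  exact (PrimeSpectrum.le_iff_specializes p ⟨m, hm.isPrime⟩).mp hpm

variable [IsAlgClosed K] [Algebra.FiniteType K A]

/-- The sum `α + β` is the component of `rep_{|α| + |β|} A` containing `M ⊕ N` for one, equivalently
(see `Comp.dirSum_mem_add`) for all, `M ∈ rep_α A` and `N ∈ rep_β A`. -/
noncomputable instance : Add (Comp K A) where
  add α β := ⟨α.dim + β.dim,
    ConnectedComponents.mk (Rep.point (dirSum α.exists_mem.choose β.exists_mem.choose))⟩

theorem Comp.dirSum_mem_add {α β : Comp K A} {M : Rep K A α.dim} {N : Rep K A β.dim}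
    (hM : α.Mem M) (hN : β.Mem N) : (α + β).Mem (dirSum M N) :=
  (dirSum_left N (hM.trans α.exists_mem.choose_spec.symm)).trans
    (dirSum_right _ (hN.trans β.exists_mem.choose_spec.symm))

end Components

/-! ## Modules, `Hom`, `Ext` and the Euler characteristic -/

section Euler

variable {K A : Type u} [Field K] [Ring A] [Algebra K A]

/-- The left `A`-module `K^n` given by a representation `A → M_n(K)`. -/
@[nolint unusedArguments]
def RepMod {n : ℕ} (_M : Rep K A n) : Type u := Fin n → K

variable {n m : ℕ}

instance (M : Rep K A n) : AddCommGroup (RepMod M) := inferInstanceAs (AddCommGroup (Fin n → K))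

instance (M : Rep K A n) : Module K (RepMod M) := inferInstanceAs (Module K (Fin n → K))

/-- An element `a` acts on column vectors as the matrix `M a`. -/
instance (M : Rep K A n) : Module A (RepMod M) where
  smul a v := (M a).mulVec v
  one_smul v := (congrArg (Matrix.mulVec · v) (map_one M)).trans (Matrix.one_mulVec v)
  mul_smul a b v :=
    (congrArg (Matrix.mulVec · v) (map_mul M a b)).trans (Matrix.mulVec_mulVec v (M a) (M b)).symm
  smul_zero a := Matrix.mulVec_zero (M a)
  smul_add a v w := Matrix.mulVec_add (M a) v w
  add_smul a b v :=
    (congrArg (Matrix.mulVec · v) (map_add M a b)).trans (Matrix.add_mulVec (M a) (M b) v)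
  zero_smul v := (congrArg (Matrix.mulVec · v) (map_zero M)).trans (Matrix.zero_mulVec v)

theorem RepMod.smul_def (M : Rep K A n) (a : A) (v : RepMod M) : a • v = (M a).mulVec v := rfl

instance (M : Rep K A n) : SMulCommClass A K (RepMod M) :=
  ⟨fun a c v => Matrix.mulVec_smul (M a) c v⟩

instance (M : Rep K A n) : IsScalarTower K A (RepMod M) :=
  ⟨fun c a v =>
    (congrArg (Matrix.mulVec · v) (map_smul M c a)).trans (Matrix.smul_mulVec c (M a) v)⟩

/-- `Hom_A(M, N)`. -/
abbrev HomA (M : Rep K A n) (N : Rep K A m) : Type u := RepMod M →ₗ[A] RepMod N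

/-- `Ext^1_A(M, N)`. -/
abbrev ExtA (M : Rep K A n) (N : Rep K A m) : Type u :=
  CategoryTheory.Abelian.Ext.{u} (ModuleCat.of A (RepMod M)) (ModuleCat.of A (RepMod N)) 1

/-- `χ_A(M, N) = dim_K Hom_A(M, N) - dim_K Ext^1_A(M, N)`. -/
noncomputable def chi (M : Rep K A n) (N : Rep K A m) : ℤ :=
  (Module.finrank K (HomA M N) : ℤ) - (Module.finrank K (ExtA M N) : ℤ)

end Euler

/-- A `K`-qurve: a finitely generated `K`-algebra with the lifting property modulo nilpotent
two-sided ideals in the category of (not necessarily commutative) `K`-algebras. -/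
structure IsQurve (K A : Type u) [Field K] [Ring A] [Algebra K A] : Prop where
  finiteType : Algebra.FiniteType K A
  exists_lift : ∀ (B : Type u) [Ring B] [Algebra K B] (I : Ideal B) [I.IsTwoSided],
    IsNilpotent I → ∀ f : A →ₐ[K] B ⧸ I, ∃ g : A →ₐ[K] B, (Ideal.Quotient.mkₐ K I).comp g = f

end NCRep

set_option maxSynthPendingDepth 3
set_option linter.unusedSectionVars false

section

open TensorProduct

/-! The tangent space of `rep_n A` at a `K`-point `M` is the space of derivations `A → End_K(M)`:
both describe the lifts of `M` to the dual numbers (`tangentMap`). The exact sequence `0 → Hom_A(V,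
W) → Hom_K(V, W) → Der(A, Hom_K(V, W)) → Ext^1_A(V, W) → 0` shows that this space has dimension `n²
- χ(M, M)` (`finrank_tangentSpace_classify`).

On a smooth component the tangent dimension at a rational point is the local rank of the projective
module of differentials. The rank is locally constant, hence constant by connectedness, and equals
the Krull dimension, because étale coordinates to affine space give every maximal ideal that height
(`Algebra.Smooth.ringKrullDim_eq`, `exists_dim_of_smooth_component`). This is the dimension formula.

The sequence also makes `χ` biadditive on direct sums, since spaces of derivations are. Constancy of
the symmetrized form then follows by polarization from `χ(M ⊕ N, M ⊕ N)` (`chi_add_chi_eq`). For a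
qurve, lifting along `M_n(C) → M_n(C/I)` makes every `rep_n A` formally smooth, so the form is
defined everywhere; it is additive because direct sums of points lie in the sum of their components.
-/

/-! ### Krull dimension of smooth algebras over a field. -/

theorem MvPolynomial.height_eq_of_isMaximal {K : Type*} [Field K] (n : ℕ)
    (m : Ideal (MvPolynomial (Fin n) K)) [hm : m.IsMaximal] : m.height = n := by
  induction n with
  | zero =>
    refine le_antisymm ?_ (by simp)
    have h := Ideal.height_le_ringKrullDim_of_ne_top hm.ne_top
    rw [MvPolynomial.ringKrullDim_of_isNoetherianRing] at h
    simpa using h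
  | succ n ih =>
    let e := (MvPolynomial.finSuccEquiv K n).toRingEquiv
    rw [← RingEquiv.height_comap e.symm m]
    have hP : (m.comap e.symm).IsMaximal := inferInstance
    generalize m.comap e.symm = P at hP
    -- Polynomial rings over a field are Jacobson, so the contraction stays maximal and the
    -- induction hypothesis applies to it; the last variable adds one to the height.
    have hp : (P.comap Polynomial.C).IsMaximal :=
      Polynomial.isMaximal_comap_C_of_isJacobsonRing _
    have : P.LiesOver (P.comap Polynomial.C) := ⟨rfl⟩
    rw [Polynomial.height_eq_height_add_one (P.comap Polynomial.C) P, ih]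
    simp

/-- By going down, the height upstairs is the height of the contraction plus the height of `P` in
the fibre, and the fibre contributes zero because étale maps are quasi-finite. -/
theorem Algebra.Etale.height_eq_height_under {R T : Type*} [CommRing R] [CommRing T] [Algebra R T]
    [Algebra.Etale R T] [IsNoetherianRing R] [IsNoetherianRing T] (P : Ideal T) [hP : P.IsPrime] :
    P.height = (P.under R).height := by
  rw [Ideal.height_eq_height_add_of_liesOver_of_hasGoingDown (P.under R) P]
  convert! add_zero _
  let q := Ideal.Quotient.mk ((P.under R).map (algebraMap R T))
  have hle : (P.under R).map (algebraMap R T) ≤ P := Ideal.map_comap_le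
  have hP' : (P.map q).IsPrime :=
    Ideal.map_isPrime_of_surjective Ideal.Quotient.mk_surjective (by rwa [Ideal.mk_ker])
  have hc : (P.map q).comap q = P := by
    rw [Ideal.comap_map_of_surjective _ Ideal.Quotient.mk_surjective, ← RingHom.ker_eq_comap_bot,
      Ideal.mk_ker, sup_eq_left.mpr hle]
  rw [Ideal.height_eq_zero_iff]
  refine ⟨⟨hP', bot_le⟩, fun Q hQ hQP => ?_⟩
  have := hQ.1
  have h : Q.comap q = P := by
    have h1 : Q.comap q ≤ P := (Ideal.comap_mono hQP).trans hc.le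
    -- In a quasi-finite algebra, nested primes with the same contraction coincide, so `P` is
    -- minimal over the extension of its contraction.
    refine Algebra.QuasiFinite.eq_of_le_of_under_eq (R := R) _ _ h1
      (le_antisymm (Ideal.comap_mono h1) ?_)
    rw [← Ideal.map_le_iff_le_comap]
    conv_lhs => rw [← Ideal.mk_ker (I := (P.under R).map (algebraMap R T))]
    exact Ideal.comap_mono bot_le
  exact Ideal.map_le_iff_le_comap.mpr h.ge

/-- Étale coordinates preserve heights, which reduces the claim to affine `n`-space. The contraction
of `P` is maximal because `T ⧸ P` is finite over `K` (Nullstellensatz), hence integral over the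
polynomial ring. -/
theorem Algebra.IsStandardSmoothOfRelativeDimension.height_eq_of_isMaximal {K T : Type*} [Field K]
    [CommRing T] [Algebra K T] (n : ℕ) [Algebra.IsStandardSmoothOfRelativeDimension n K T]
    (P : Ideal T) [hP : P.IsMaximal] : P.height = n := by
  obtain ⟨g, hg⟩ :=
    Algebra.IsStandardSmoothOfRelativeDimension.exists_etale_mvPolynomial n K T
  algebraize [g.toRingHom]
  have : IsNoetherianRing T := Algebra.FiniteType.isNoetherianRing (MvPolynomial (Fin n) K) T
  rw [Algebra.Etale.height_eq_height_under (R := MvPolynomial (Fin n) K) P]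
  have : (P.under (MvPolynomial (Fin n) K)).IsMaximal := by
    let _ : Field (T ⧸ P) := Ideal.Quotient.field P
    have : Algebra.IsStandardSmooth K T :=
      Algebra.IsStandardSmoothOfRelativeDimension.isStandardSmooth n
    have : Module.Finite K (T ⧸ P) := finite_of_finite_type_of_isJacobsonRing K (T ⧸ P)
    have : Algebra.IsIntegral (MvPolynomial (Fin n) K) (T ⧸ P) := Algebra.IsIntegral.tower_top K
    have h := Ideal.isMaximal_comap_of_isIntegral_of_isMaximal (R := MvPolynomial (Fin n) K)
      (⊥ : Ideal (T ⧸ P))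
    rwa [IsScalarTower.algebraMap_eq _ T, ← Ideal.comap_comap, ← RingHom.ker_eq_comap_bot,
      Ideal.Quotient.algebraMap_eq, Ideal.mk_ker] at h
  exact MvPolynomial.height_eq_of_isMaximal n _

/-- A smooth algebra of constant relative dimension `d` over a field has Krull dimension `d`. -/
theorem Algebra.Smooth.ringKrullDim_eq {K S : Type*} [Field K] [CommRing S] [Algebra K S]
    [Algebra.Smooth K S] [Nontrivial S] (d : ℕ)
    (hd : ∀ p : PrimeSpectrum S, Module.rankAtStalk Ω[S⁄K] p = d) : ringKrullDim S = d := by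
  have key (m : Ideal S) [hm : m.IsMaximal] : m.height = d := by
    obtain ⟨f, hf, hs⟩ := Algebra.IsSmoothAt.exists_notMem_isStandardSmooth K m
    let T := Localization.Away f
    have hdisj : Disjoint (Submonoid.powers f : Set S) m :=
      (Ideal.disjoint_powers_iff_notMem_of_isPrime _).mpr hf
    have hmT : (m.map (algebraMap S T)).IsMaximal :=
      have : IsJacobsonRing S := isJacobsonRing_of_finiteType (A := K)
      IsLocalization.isMaximal_of_isMaximal_disjoint f m hm hf
    have : Nontrivial T := (Submodule.nontrivial_iff T).mp ⟨_, _, hmT.ne_top⟩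
    -- The relative dimension of a standard smooth chart is the rank of its differentials, which are
    -- the base change of those of `S` along the localization.
    have : Algebra.IsStandardSmoothOfRelativeDimension d K T := by
      rw [Algebra.IsStandardSmoothOfRelativeDimension.iff_of_isStandardSmooth]
      have hr (p : PrimeSpectrum T) : Module.rankAtStalk Ω[T⁄K] p = d := by
        have := Algebra.FormallyEtale.of_isLocalization (Rₘ := T) (Submonoid.powers f)
        rw [Module.rankAtStalk_isBaseChange
          (KaehlerDifferential.isBaseChange_of_formallyEtale K S T) p, hd]
      have : Module.Finite T Ω[T⁄K] := inferInstance
      have := hr (Classical.arbitrary _)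
      rw [Module.rankAtStalk_eq_finrank_of_free] at this
      rw [← Module.finrank_eq_rank, ← this]
      rfl
    rw [← IsLocalization.height_map_of_disjoint (S := T) (Submonoid.powers f) m hdisj]
    exact Algebra.IsStandardSmoothOfRelativeDimension.height_eq_of_isMaximal (K := K) d _
  refine le_antisymm ?_ ?_
  · rw [ringKrullDim_le_iff_isMaximal_height_le]
    intro m hm
    rw [key m]
    rfl
  · obtain ⟨m, hm⟩ := Ideal.exists_maximal S
    have := Ideal.height_le_ringKrullDim_of_ne_top hm.ne_top
    rwa [key m] at this

/-! ### Derivations into `Hom_K(V, W)` and homomorphisms on the kernel of `A ⊗ V → V`. -/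

namespace NCRep

section BimoduleDerivations

variable (K A : Type u) [Field K] [Ring A] [Algebra K A]
variable (V W : Type u) [AddCommGroup V] [Module K V] [Module A V] [IsScalarTower K A V]
  [AddCommGroup W] [Module K W] [Module A W] [IsScalarTower K A W]

/-- The space of `K`-linear derivations from `A` to the bimodule `Hom_K(V, W)`. -/
def BimodDer : Submodule K (A →ₗ[K] V →ₗ[K] W) where
  carrier := {d | ∀ a b v, d (a * b) v = a • d b v + d a (b • v)}
  zero_mem' a b := by simp
  add_mem' {d e} hd he a b v := by
    simp only [LinearMap.add_apply, hd a b, he a b, smul_add]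
    abel
  smul_mem' c d hd a b v := by
    simp only [LinearMap.smul_apply, hd a b, smul_add]
    rw [smul_algebra_smul_comm]

variable {K A V W}

namespace BimodDer

theorem map_mul_apply (d : BimodDer K A V W) (a b : A) (v : V) :
    d.1 (a * b) v = a • d.1 b v + d.1 a (b • v) := d.2 a b v

theorem map_one_apply (d : BimodDer K A V W) (v : V) : d.1 1 v = 0 := by
  simpa using map_mul_apply d 1 1 v

instance [Algebra.FiniteType K A] [Module.Finite K V] [Module.Finite K W] :
    Module.Finite K (BimodDer K A V W) := by
  obtain ⟨S, hS⟩ := (inferInstance : Algebra.FiniteType K A).out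
  let ev : BimodDer K A V W →ₗ[K] (S → V →ₗ[K] W) :=
    LinearMap.pi fun s => (LinearMap.applyₗ (s : A)).comp (BimodDer K A V W).subtype
  -- A derivation is determined by its values on a finite set of algebra generators.
  refine Module.Finite.of_injective ev fun d e hde =>
    Subtype.ext (LinearMap.ext fun a => LinearMap.ext ?_)
  have ha : a ∈ Algebra.adjoin K (S : Set A) := hS ▸ Algebra.mem_top
  induction ha using Algebra.adjoin_induction with
  | mem x hx => exact fun v => congrArg (· v) (congrFun hde ⟨x, hx⟩)
  | algebraMap c =>
    intro v
    rw [Algebra.algebraMap_eq_smul_one, map_smul, LinearMap.smul_apply, map_one_apply, map_smul,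
      LinearMap.smul_apply, map_one_apply]
  | add x y _ _ hx hy =>
    intro v
    rw [map_add, LinearMap.add_apply, hx, hy, map_add, LinearMap.add_apply]
  | mul x y _ _ hx hy =>
    intro v
    rw [map_mul_apply, hx, hy, map_mul_apply]

variable (K A V W) in
/-- The inner derivations `a ↦ aX - Xa`. -/
noncomputable def inner : (V →ₗ[K] W) →ₗ[K] BimodDer K A V W where
  toFun X := ⟨LinearMap.mk₂ K (fun a v => a • X v - X (a • v))
      (fun a b v => by simp only [add_smul, map_add]; abel)
      (fun c a v => by simp only [smul_assoc, map_smul, smul_sub])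
      (fun a v w => by simp only [smul_add, map_add]; abel)
      (fun c a v => by
        simp only [map_smul, smul_sub, smul_algebra_smul_comm c a]),
    fun a b v => by
      simp only [LinearMap.mk₂_apply, mul_smul, smul_sub]
      abel⟩
  map_add' X Y := by
    refine Subtype.ext (LinearMap.ext₂ fun a v => ?_)
    simp only [Submodule.coe_add, LinearMap.add_apply, LinearMap.mk₂_apply, smul_add]
    abel
  map_smul' c X := by
    refine Subtype.ext (LinearMap.ext₂ fun a v => ?_)
    simp only [Submodule.coe_smul, LinearMap.smul_apply, LinearMap.mk₂_apply, smul_sub,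
      RingHom.id_apply, smul_algebra_smul_comm c a]

theorem inner_apply (X : V →ₗ[K] W) (a : A) (v : V) :
    (inner K A V W X).1 a v = a • X v - X (a • v) := rfl

theorem ker_inner :
    LinearMap.ker (inner K A V W) = LinearMap.range (LinearMap.restrictScalarsₗ K A V W K) := by
  ext X
  constructor
  · intro h
    have h (a : A) (v : V) : X (a • v) = a • X v := by
      have := congrArg (fun d => d.1 a v) (LinearMap.mem_ker.mp h)
      exact (sub_eq_zero.mp this).symm
    exact ⟨{ X with map_smul' := h }, rfl⟩
  · rintro ⟨f, rfl⟩
    refine Subtype.ext (LinearMap.ext₂ fun a v => ?_)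
    exact sub_eq_zero.mpr (f.map_smul a v).symm

variable (K A V) in
/-- The action map `A ⊗ V → V`. -/
noncomputable def actionMap : A ⊗[K] V →ₗ[A] V :=
  AlgebraTensorModule.lift
    { toFun := fun a => Algebra.lsmul K K V a
      map_add' := map_add _
      map_smul' := fun a b => by
        ext v
        simp }

@[simp]
theorem actionMap_tmul (a : A) (v : V) : actionMap K A V (a ⊗ₜ v) = a • v := rfl

theorem actionMap_surjective : Function.Surjective (actionMap K A V) := fun v =>
  ⟨1 ⊗ₜ v, one_smul A v⟩

/-- The defect of `A`-linearity factors through the action map, so the extension of `d` to `A ⊗ V`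
becomes `A`-linear on the kernel. -/
theorem lift_smul (d : BimodDer K A V W) (a : A) (t : A ⊗[K] V) :
    TensorProduct.lift d.1 (a • t) = a • TensorProduct.lift d.1 t + d.1 a (actionMap K A V t) := by
  induction t with
  | zero => simp
  | tmul b v => simp [smul_tmul', map_mul_apply d]
  | add x y hx hy =>
    rw [smul_add, map_add, hx, hy, map_add, smul_add, map_add, map_add]
    abel

variable (K A V W) in
/-- A derivation with values in `Hom_K(V, W)` gives a homomorphism from the kernel of `A ⊗ V → V`
to `W`. -/
noncomputable def toHomKer :
    BimodDer K A V W →ₗ[K] (LinearMap.ker (actionMap K A V) →ₗ[A] W) where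
  toFun d :=
    { toFun := fun t => TensorProduct.lift d.1 t.1
      map_add' := fun x y => map_add _ x.1 y.1
      map_smul' := fun a t => by
        rw [Submodule.coe_smul, lift_smul d, LinearMap.mem_ker.mp t.2, map_zero, add_zero]
        rfl }
  map_add' d e := by
    ext t
    simp only [Submodule.coe_add, LinearMap.coe_mk, AddHom.coe_mk, LinearMap.add_apply]
    generalize t.1 = t
    induction t with
    | zero => simp
    | tmul b v => simp
    | add x y hx hy =>
      rw [map_add, map_add, map_add, hx, hy]
      abel
  map_smul' c d := by
    ext t
    simp only [Submodule.coe_smul, LinearMap.coe_mk, AddHom.coe_mk, LinearMap.smul_apply,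
      RingHom.id_apply]
    generalize t.1 = t
    induction t with
    | zero => simp
    | tmul b v => simp
    | add x y hx hy =>
      rw [map_add, map_add, hx, hy, smul_add]

theorem toHomKer_apply (d : BimodDer K A V W) (t : LinearMap.ker (actionMap K A V)) :
    toHomKer K A V W d t = TensorProduct.lift d.1 t.1 := rfl

variable (K) in
/-- The relation `a ⊗ v - 1 ⊗ a v`. -/
noncomputable def kerElt (a : A) (v : V) : LinearMap.ker (actionMap K A V) :=
  ⟨a ⊗ₜ v - 1 ⊗ₜ (a • v), by simp⟩

theorem toHomKer_kerElt (d : BimodDer K A V W) (a : A) (v : V) :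
    toHomKer K A V W d (kerElt K a v) = d.1 a v := by
  rw [toHomKer_apply, kerElt, map_sub, lift.tmul, lift.tmul, map_one_apply d, sub_zero]

/-- An element `t` of the kernel equals `t - 1 ⊗ (action of t)`. This expression is additive in `t`
and makes sense for all `t`, so induction on tensors shows that the elements `kerElt` generate the
kernel. -/
theorem hom_ker_ext {f g : LinearMap.ker (actionMap K A V) →ₗ[A] W}
    (h : ∀ a v, f (kerElt K a v) = g (kerElt K a v)) : f = g := by
  have key (t : A ⊗[K] V) (ht : t - 1 ⊗ₜ[K] actionMap K A V t ∈ LinearMap.ker (actionMap K A V)) :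
      f ⟨_, ht⟩ = g ⟨_, ht⟩ := by
    induction t with
    | zero =>
      have : (⟨_, ht⟩ : LinearMap.ker (actionMap K A V)) = 0 := by ext; simp
      rw [this, map_zero, map_zero]
    | tmul a v => exact h a v
    | add x y hx hy =>
      have hk (z : A ⊗[K] V) :
          z - 1 ⊗ₜ[K] actionMap K A V z ∈ LinearMap.ker (actionMap K A V) := by simp
      have : (⟨_, ht⟩ : LinearMap.ker (actionMap K A V)) = ⟨_, hk x⟩ + ⟨_, hk y⟩ := by
        ext
        simp only [map_add, tmul_add, Submodule.coe_add]
        abel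
      rw [this, map_add, map_add, hx, hy]
  ext ⟨t, ht⟩
  have := key t (by simp)
  simp only [LinearMap.mem_ker.mp ht, tmul_zero, sub_zero] at this
  exact this

/-- The preimage of `f` is `d(a)v = f(a ⊗ v - 1 ⊗ av)`. The Leibniz rule comes from `ab ⊗ v - 1 ⊗
abv = a(b ⊗ v - 1 ⊗ bv) + (a ⊗ bv - 1 ⊗ abv)`. -/
theorem toHomKer_surjective : Function.Surjective (toHomKer K A V W) := fun f => by
  refine ⟨⟨LinearMap.mk₂ K (fun a v => f (kerElt K a v)) ?_ ?_ ?_ ?_, ?_⟩, ?_⟩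
  · intro a b v
    rw [← map_add]
    congr 1
    ext
    simp only [kerElt, add_smul, add_tmul, tmul_add, Submodule.coe_add]
    abel
  · intro c a v
    rw [← algebraMap_smul A c (f _), ← map_smul]
    congr 1
    ext
    simp only [kerElt, Submodule.coe_smul_of_tower, smul_assoc, algebraMap_smul, smul_sub,
      ← smul_tmul', tmul_smul]
  · intro a v w
    rw [← map_add]
    congr 1
    ext
    simp only [kerElt, smul_add, tmul_add, Submodule.coe_add]
    abel
  · intro c a v
    rw [← algebraMap_smul A c (f _), ← map_smul]
    congr 1
    ext
    simp only [kerElt, Submodule.coe_smul_of_tower, algebraMap_smul, smul_sub,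
      tmul_smul, smul_algebra_smul_comm c a v]
  · intro a b v
    simp only [LinearMap.mk₂_apply]
    rw [← map_smul, ← map_add]
    congr 1
    ext
    simp only [kerElt, mul_smul, Submodule.coe_add, Submodule.coe_smul, smul_sub, smul_tmul',
      smul_eq_mul, mul_one]
    abel
  · exact hom_ker_ext fun a v => by rw [toHomKer_kerElt]; rfl

end BimodDer

end BimoduleDerivations
end NCRep

/-! ### `Ext^1` as derivations modulo inner derivations. -/

namespace NCRep

section BimoduleDerivations

variable (K A : Type u) [Field K] [Ring A] [Algebra K A]
variable (V W : Type u) [AddCommGroup V] [Module K V] [Module A V] [IsScalarTower K A V]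
  [AddCommGroup W] [Module K W] [Module A W] [IsScalarTower K A W]

open CategoryTheory

/-- `Ext^1_A(V, W)`. -/
abbrev Ext1 : Type u := Abelian.Ext.{u} (ModuleCat.of A V) (ModuleCat.of A W) 1

namespace BimodDer

theorem shortExact_actionMap : (actionMap K A V).shortComplexKer.ShortExact :=
  LinearMap.shortExact_shortComplexKer actionMap_surjective

/-- The connecting map `Hom_A(Ω, W) → Ext^1_A(V, W)`, where `Ω` is the kernel of `A ⊗ V → V`. -/
noncomputable def connecting :
    (LinearMap.ker (actionMap K A V) →ₗ[A] W) →ₗ[K] Ext1 A V W where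
  toFun f := (shortExact_actionMap K A V).extClass.comp
    (Abelian.Ext.mk₀ (ModuleCat.ofHom f)) (add_zero 1)
  map_add' f g := by
    rw [ModuleCat.ofHom_add, Abelian.Ext.mk₀_add, Abelian.Ext.comp_add]
  map_smul' c f := by
    have : Abelian.Ext.mk₀ (ModuleCat.ofHom (R := A) (X := LinearMap.ker (actionMap K A V)) (Y := W)
        (c • f)) = c • Abelian.Ext.mk₀ (ModuleCat.ofHom f) := by
      rw [← Abelian.Ext.mk₀_smul]
      congr 1
      ext t
      exact (algebraMap_smul A c (f t)).symm
    rw [this, Abelian.Ext.comp_smul]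
    rfl

variable {K A V W}

/-- Over the field `K` the space `V` is free, so `A ⊗ V` is projective over `A` and `Ext^1_A(A ⊗ V,
W)` vanishes in the long exact sequence. -/
theorem connecting_surjective : Function.Surjective (connecting K A V W) := fun x => by
  have : Projective (actionMap K A V).shortComplexKer.X₂ :=
    (IsProjective.iff_projective (R := A) (A ⊗[K] V)).mp inferInstance
  obtain ⟨y, hy⟩ := Abelian.Ext.contravariant_sequence_exact₃ (shortExact_actionMap K A V) _ x
    (Abelian.Ext.eq_zero_of_projective _) (add_zero 1)
  obtain ⟨f, rfl⟩ := Abelian.Ext.mk₀_bijective _ _ |>.2 y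
  exact ⟨f.hom, hy⟩

theorem connecting_eq_zero_iff (f : LinearMap.ker (actionMap K A V) →ₗ[A] W) :
    connecting K A V W f = 0 ↔
      ∃ g : A ⊗[K] V →ₗ[A] W, g.comp (LinearMap.ker (actionMap K A V)).subtype = f := by
  constructor
  · intro h
    obtain ⟨y, hy⟩ := Abelian.Ext.contravariant_sequence_exact₁ (shortExact_actionMap K A V) _
      (Abelian.Ext.mk₀ (ModuleCat.ofHom f)) (add_zero 1) h
    obtain ⟨g, rfl⟩ := Abelian.Ext.mk₀_bijective _ _ |>.2 y
    rw [Abelian.Ext.mk₀_comp_mk₀] at hy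
    exact ⟨g.hom, congrArg ModuleCat.Hom.hom ((Abelian.Ext.mk₀_bijective _ _).1 hy)⟩
  · rintro ⟨g, rfl⟩
    have : ModuleCat.ofHom (g.comp (LinearMap.ker (actionMap K A V)).subtype) =
      (actionMap K A V).shortComplexKer.f ≫ ModuleCat.ofHom g := rfl
    change (shortExact_actionMap K A V).extClass.comp (Abelian.Ext.mk₀ (ModuleCat.ofHom
      (g.comp (LinearMap.ker (actionMap K A V)).subtype))) (add_zero 1) = 0
    rw [this, ← Abelian.Ext.mk₀_comp_mk₀, ← Abelian.Ext.comp_assoc_of_second_deg_zero,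
      ShortComplex.ShortExact.extClass_comp, Abelian.Ext.zero_comp]

variable (K A V W) in
/-- The class in `Ext^1_A(V, W)` of a derivation. -/
noncomputable def toExt : BimodDer K A V W →ₗ[K] Ext1 A V W :=
  (connecting K A V W).comp (toHomKer K A V W)

theorem toExt_surjective : Function.Surjective (toExt K A V W) :=
  connecting_surjective.comp toHomKer_surjective

/-- Maps `A ⊗ V → W` over `A` correspond to `K`-linear maps `X : V → W`. On `a ⊗ v - 1 ⊗ av` such a
map takes the value `aX(v) - X(av)`, so the homomorphisms that extend to `A ⊗ V` come exactly from
inner derivations. -/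
theorem ker_toExt : LinearMap.ker (toExt K A V W) = LinearMap.range (inner K A V W) := by
  ext d
  rw [LinearMap.mem_ker, toExt, LinearMap.comp_apply, connecting_eq_zero_iff]
  constructor
  · rintro ⟨g, hg⟩
    refine ⟨(g.restrictScalars K).comp (TensorProduct.mk K A V 1),
      Subtype.ext (LinearMap.ext₂ fun a v => ?_)⟩
    rw [← toHomKer_kerElt d a v, ← hg]
    simp [inner_apply, kerElt, ← map_smul, smul_tmul']
  · rintro ⟨X, rfl⟩
    refine ⟨AlgebraTensorModule.lift
      { toFun := fun a => (Algebra.lsmul K K W a).comp X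
        map_add' := fun a b => by ext v; simp
        map_smul' := fun a b => by ext v; simp }, hom_ker_ext fun a v => ?_⟩
    rw [toHomKer_kerElt, inner_apply]
    simp [kerElt]

instance [Algebra.FiniteType K A] [Module.Finite K V] [Module.Finite K W] :
    Module.Finite K (Ext1 A V W) :=
  Module.Finite.of_surjective (toExt K A V W) toExt_surjective

theorem restrictScalarsₗ_injective :
    Function.Injective (LinearMap.restrictScalarsₗ K A V W K) :=
  LinearMap.restrictScalars_injective K

instance [Module.Finite K V] [Module.Finite K W] : Module.Finite K (V →ₗ[A] W) :=
  Module.Finite.of_injective _ restrictScalarsₗ_injective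

/-- The dimension count in the exact sequence
`0 → Hom_A(V, W) → Hom_K(V, W) → Der(A, Hom_K(V, W)) → Ext^1_A(V, W) → 0`. -/
theorem finrank_add_finrank_hom [Algebra.FiniteType K A] [Module.Finite K V] [Module.Finite K W] :
    Module.finrank K (BimodDer K A V W) + Module.finrank K (V →ₗ[A] W) =
      Module.finrank K V * Module.finrank K W + Module.finrank K (Ext1 A V W) := by
  have h1 := LinearMap.finrank_range_add_finrank_ker (K := K) (V := V →ₗ[K] W)
    (V₂ := BimodDer K A V W) (inner K A V W)
  have h2 := LinearMap.finrank_range_add_finrank_ker (K := K) (V := BimodDer K A V W)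
    (V₂ := Ext1 A V W) (toExt K A V W)
  rw [ker_inner, LinearMap.finrank_range_of_inj restrictScalarsₗ_injective,
    Module.finrank_linearMap K K V W] at h1
  rw [ker_toExt, LinearMap.range_eq_top.mpr toExt_surjective, finrank_top] at h2
  omega

end BimodDer

end BimoduleDerivations
end NCRep

/-! ### Biadditivity of the Euler characteristic. -/

namespace NCRep

section Additivity

variable {K A : Type u} [Field K] [Ring A] [Algebra K A]

namespace BimodDer

variable {U V V' W W' : Type u} [AddCommGroup V] [Module K V] [Module A V] [IsScalarTower K A V]
  [AddCommGroup V'] [Module K V'] [Module A V'] [IsScalarTower K A V']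
  [AddCommGroup U] [Module K U] [Module A U] [IsScalarTower K A U]
  [AddCommGroup W] [Module K W] [Module A W] [IsScalarTower K A W]
  [AddCommGroup W'] [Module K W'] [Module A W'] [IsScalarTower K A W']

/-- Functoriality of `Der(A, Hom_K(V, W))` in `V` and `W`. -/
noncomputable def map (f : V' →ₗ[A] V) (g : W →ₗ[A] W') :
    BimodDer K A V W →ₗ[K] BimodDer K A V' W' where
  toFun d := ⟨(d.1.compl₂ (f.restrictScalars K)).compr₂ (g.restrictScalars K), fun a b v => by
    simp [map_mul_apply d]⟩
  map_add' d e := Subtype.ext (LinearMap.ext₂ fun a v => by simp)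
  map_smul' c d := Subtype.ext (LinearMap.ext₂ fun a v => by simp)

theorem map_apply (f : V' →ₗ[A] V) (g : W →ₗ[A] W') (d : BimodDer K A V W) (a : A) (v : V') :
    (map f g d).1 a v = g (d.1 a (f v)) := rfl

variable (W) in
/-- `Der(A, Hom_K(V, W))` is additive in `V`. -/
noncomputable def prodLeftEquiv (e : U ≃ₗ[A] V × V') :
    BimodDer K A U W ≃ₗ[K] BimodDer K A V W × BimodDer K A V' W :=
  LinearEquiv.ofLinearMap
    ((map (e.symm.toLinearMap.comp (LinearMap.inl A V V')) LinearMap.id).prod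
      (map (e.symm.toLinearMap.comp (LinearMap.inr A V V')) LinearMap.id))
    ((map ((LinearMap.fst A V V').comp e.toLinearMap) LinearMap.id).coprod
      (map ((LinearMap.snd A V V').comp e.toLinearMap) LinearMap.id))
    (LinearMap.ext fun ⟨d, d'⟩ => Prod.ext
      (Subtype.ext (LinearMap.ext₂ fun a v => by simp [map_apply]))
      (Subtype.ext (LinearMap.ext₂ fun a v => by simp [map_apply])))
    (LinearMap.ext fun d => Subtype.ext (LinearMap.ext₂ fun a v => by
      simp [map_apply, ← map_add]))

variable (V) in
/-- `Der(A, Hom_K(V, W))` is additive in `W`. -/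
noncomputable def prodRightEquiv (e : U ≃ₗ[A] W × W') :
    BimodDer K A V U ≃ₗ[K] BimodDer K A V W × BimodDer K A V W' :=
  LinearEquiv.ofLinearMap
    ((map LinearMap.id ((LinearMap.fst A W W').comp e.toLinearMap)).prod
      (map LinearMap.id ((LinearMap.snd A W W').comp e.toLinearMap)))
    ((map LinearMap.id (e.symm.toLinearMap.comp (LinearMap.inl A W W'))).coprod
      (map LinearMap.id (e.symm.toLinearMap.comp (LinearMap.inr A W W'))))
    (LinearMap.ext fun ⟨d, d'⟩ => Prod.ext
      (Subtype.ext (LinearMap.ext₂ fun a v => by simp [map_apply]))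
      (Subtype.ext (LinearMap.ext₂ fun a v => by simp [map_apply])))
    (LinearMap.ext fun d => Subtype.ext (LinearMap.ext₂ fun a v => by
      simp [map_apply, ← map_add]))

end BimodDer

variable {n m k : ℕ}

instance (M : Rep K A n) : Module.Finite K (RepMod M) :=
  inferInstanceAs (Module.Finite K (Fin n → K))

theorem finrank_repMod (M : Rep K A n) : Module.finrank K (RepMod M) = n :=
  Module.finrank_fin_fun K

/-- This turns statements about `χ` into statements about spaces of derivations. Additivity of `χ`
is thus deduced from that of derivations, without decomposing `Ext^1`. -/
theorem finrank_bimodDer [Algebra.FiniteType K A] (M : Rep K A n) (N : Rep K A m) :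
    (Module.finrank K (BimodDer K A (RepMod M) (RepMod N)) : ℤ) = n * m - chi M N := by
  have h := BimodDer.finrank_add_finrank_hom (K := K) (A := A) (V := RepMod M) (W := RepMod N)
  rw [finrank_repMod, finrank_repMod] at h
  rw [chi]
  zify at h
  linarith

/-- The module of a direct sum of representations is the product of the modules. -/
noncomputable def dirSumEquiv (M : Rep K A n) (N : Rep K A m) :
    RepMod (dirSum M N) ≃ₗ[A] RepMod M × RepMod N where
  toFun v := (fun i => v (Fin.castAdd m i), fun j => v (Fin.natAdd n j))
  invFun p := Fin.append p.1 p.2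
  left_inv v := Fin.append_castAdd_natAdd
  right_inv p := Prod.ext (funext fun i => Fin.append_left _ _ i)
    (funext fun i => Fin.append_right _ _ i)
  map_add' v w := rfl
  map_smul' a v := by
    have h (w : Fin (n + m) → K) (x : Fin n ⊕ Fin m) :
        (dirSum M N a).mulVec w (finSumFinEquiv x) =
          (Matrix.fromBlocks (M a) 0 0 (N a)).mulVec (w ∘ finSumFinEquiv) x := by
      change ((Matrix.fromBlocks (M a) 0 0 (N a)).submatrix finSumFinEquiv.symm
        finSumFinEquiv.symm).mulVec w (finSumFinEquiv x) = _
      rw [Matrix.submatrix_mulVec_equiv]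
      simp
    have hl (w : Fin (n + m) → K) (i : Fin n) : (dirSum M N a).mulVec w (Fin.castAdd m i) =
        (M a).mulVec (fun i => w (Fin.castAdd m i)) i := by
      refine (h w (Sum.inl i)).trans ?_
      rw [Matrix.fromBlocks_mulVec, Sum.elim_inl, Matrix.zero_mulVec, add_zero]
      rfl
    have hr (w : Fin (n + m) → K) (j : Fin m) : (dirSum M N a).mulVec w (Fin.natAdd n j) =
        (N a).mulVec (fun j => w (Fin.natAdd n j)) j := by
      refine (h w (Sum.inr j)).trans ?_
      rw [Matrix.fromBlocks_mulVec, Sum.elim_inr, Matrix.zero_mulVec, zero_add]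
      rfl
    exact Prod.ext (funext fun i => hl v i) (funext fun j => hr v j)

theorem chi_dirSum_left [Algebra.FiniteType K A] (M : Rep K A n) (N : Rep K A m) (L : Rep K A k) :
    chi (dirSum M N) L = chi M L + chi N L := by
  have h := (BimodDer.prodLeftEquiv (K := K) (RepMod L) (dirSumEquiv M N)).finrank_eq
  rw [Module.finrank_prod] at h
  zify at h
  rw [finrank_bimodDer, finrank_bimodDer, finrank_bimodDer] at h
  push_cast at h
  linarith

theorem chi_dirSum_right [Algebra.FiniteType K A] (L : Rep K A k) (M : Rep K A n)
    (N : Rep K A m) : chi L (dirSum M N) = chi L M + chi L N := by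
  have h := (BimodDer.prodRightEquiv (K := K) (RepMod L) (dirSumEquiv M N)).finrank_eq
  rw [Module.finrank_prod] at h
  zify at h
  rw [finrank_bimodDer, finrank_bimodDer, finrank_bimodDer] at h
  push_cast at h
  linarith

end Additivity
end NCRep

/-! ### Tangent spaces at rational points and differentials. -/

/-- The Zariski tangent space of an algebra at a rational point. -/
def tangentSpace {K R : Type*} [Field K] [CommRing R] [Algebra K R] (f : R →ₐ[K] K) :
    Submodule K (R →ₗ[K] K) where
  carrier := {D | ∀ x y, D (x * y) = f x * D y + f y * D x}
  zero_mem' x y := by simp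
  add_mem' {D E} hD hE x y := by
    simp only [LinearMap.add_apply, hD x y, hE x y]
    ring
  smul_mem' c D hD x y := by
    simp only [LinearMap.smul_apply, hD x y, smul_eq_mul]
    ring

namespace tangentSpace

variable {K R S : Type*} [Field K] [CommRing R] [Algebra K R] [CommRing S] [Algebra K S]

theorem map_one {f : R →ₐ[K] K} (D : tangentSpace f) : D.1 1 = 0 := by
  simpa using D.2 1 1

/-- A tangent vector as a point over the dual numbers. -/
noncomputable def toDualNumber {f : R →ₐ[K] K} (D : tangentSpace f) : R →ₐ[K] DualNumber K :=
  AlgHom.ofLinearMap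
    (LinearMap.toSpanSingleton K _ (1 : DualNumber K) ∘ₗ f.toLinearMap +
      LinearMap.toSpanSingleton K _ (DualNumber.eps : DualNumber K) ∘ₗ D.1)
    (by simp [map_one])
    (fun x y => by
      have := D.2 x y
      ext <;> simp [this, mul_comm])

theorem toDualNumber_fst {f : R →ₐ[K] K} (D : tangentSpace f) (x : R) :
    (toDualNumber D x).fst = f x := by simp [toDualNumber]

theorem toDualNumber_snd {f : R →ₐ[K] K} (D : tangentSpace f) (x : R) :
    (toDualNumber D x).snd = D.1 x := by simp [toDualNumber]

/-- The dimension of the tangent space is the dimension of the fibre of the module of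
differentials. -/
theorem finrank_eq_finrank_fiber [Algebra.FiniteType K R] (f : R →ₐ[K] K) :
    Module.finrank K (tangentSpace f) =
      letI := f.toRingHom.toAlgebra
      Module.finrank K (K ⊗[R] Ω[R⁄K]) := by
  let _ := f.toRingHom.toAlgebra
  have : IsScalarTower K R K := IsScalarTower.of_algebraMap_eq' f.comp_algebraMap.symm
  -- Tangent vectors are derivations into `K` viewed as an `R`-module through `f`, hence form the
  -- dual of the fibre of `Ω[R⁄K]`.
  let e1 : tangentSpace f ≃ₗ[K] Derivation K R K :=
    { toFun := fun D => Derivation.mk' D.1 fun x y => D.2 x y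
      invFun := fun D => ⟨D, D.leibniz⟩
      left_inv := fun D => rfl
      right_inv := fun D => rfl
      map_add' := fun D E => rfl
      map_smul' := fun c D => rfl }
  let e2 : Derivation K R K ≃ₗ[K] (Ω[R⁄K] →ₗ[R] K) :=
    (KaehlerDifferential.linearMapEquivDerivation K R).symm.restrictScalars K
  let e3 : (Ω[R⁄K] →ₗ[R] K) ≃ₗ[K] (K ⊗[R] Ω[R⁄K] →ₗ[K] K) := LinearMap.liftBaseChangeEquiv K
  rw [(e1.trans (e2.trans e3)).finrank_eq]
  exact Subspace.dual_finrank_eq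

/-- Smoothness makes the differentials finite projective, so their rank is compatible with base
change to the point; `⊥` is the unique point of `Spec K`. -/
theorem finrank_fiber_eq_rankAtStalk [Algebra.Smooth K S] (f : S →+* K) :
    letI := f.toAlgebra
    Module.finrank K (K ⊗[S] Ω[S⁄K]) =
      Module.rankAtStalk (R := S) Ω[S⁄K] (PrimeSpectrum.comap f ⊥) := by
  let _ := f.toAlgebra
  have h := Module.rankAtStalk_baseChange (R := S) (M := Ω[S⁄K]) (S := K) (⊥ : PrimeSpectrum K)
  rw [Module.rankAtStalk_eq_finrank_of_free] at h
  exact h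

/-- Passing to a smooth localization does not change the tangent space, whose dimension is the
local rank of the module of differentials. -/
theorem finrank_eq_rankAtStalk_of_formallyEtale [Algebra.FiniteType K R] [Algebra R S]
    [IsScalarTower K R S]
    [Algebra.FormallyEtale R S] [Algebra.Smooth K S] (f : S →ₐ[K] K) :
    Module.finrank K (tangentSpace (f.comp (IsScalarTower.toAlgHom K R S))) =
      Module.rankAtStalk (R := S) Ω[S⁄K] (PrimeSpectrum.comap f.toRingHom ⊥) := by
  rw [finrank_eq_finrank_fiber, ← finrank_fiber_eq_rankAtStalk]
  let _ := f.toRingHom.toAlgebra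
  let _ := (f.comp (IsScalarTower.toAlgHom K R S)).toRingHom.toAlgebra
  have : IsScalarTower R S K := IsScalarTower.of_algebraMap_eq' rfl
  let e : K ⊗[S] (S ⊗[R] Ω[R⁄K]) ≃ₗ[K] K ⊗[S] Ω[S⁄K] :=
    TensorProduct.AlgebraTensorModule.congr (LinearEquiv.refl K K)
      (KaehlerDifferential.tensorKaehlerEquivOfFormallyEtale K R S)
  exact ((AlgebraTensorModule.cancelBaseChange R S K K Ω[R⁄K]).symm.trans e).finrank_eq

end tangentSpace

/-! ### The tangent space of the representation scheme. -/

namespace NCRep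

section Tangent

variable {K A : Type u} [Field K] [Ring A] [Algebra K A] {n m : ℕ}

/-- Matrices are linear maps between the modules of two representations. -/
noncomputable def matrixEquiv (M : Rep K A n) (N : Rep K A m) :
    Matrix (Fin m) (Fin n) K ≃ₗ[K] (RepMod M →ₗ[K] RepMod N) :=
  Matrix.toLin'

/-- The derivation identity in terms of matrices. -/
theorem comp_matrixEquiv_mem_bimodDer_iff (M : Rep K A n) (N : Rep K A m) (d : A →ₗ[K] Matrix (Fin m) (Fin n) K) :
    (matrixEquiv M N).toLinearMap.comp d ∈ BimodDer K A (RepMod M) (RepMod N) ↔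
      ∀ a b, d (a * b) = N a * d b + d a * M b := by
  have key (a b : A) (v : Fin n → K) : N a * d b + d a * M b = d (a * b) →
      (d (a * b)).mulVec v = (N a).mulVec ((d b).mulVec v) + (d a).mulVec ((M b).mulVec v) := by
    intro h
    rw [← h, Matrix.add_mulVec, Matrix.mulVec_mulVec, Matrix.mulVec_mulVec]
  constructor
  · intro h a b
    refine Matrix.ext_of_mulVec_single fun j => ?_
    rw [Matrix.add_mulVec, ← Matrix.mulVec_mulVec, ← Matrix.mulVec_mulVec]
    exact h a b (Pi.single j 1 : Fin n → K)
  · intro h a b v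
    exact key a b v (h a b).symm

/-- The derivation attached to a tangent vector of `rep_n A`. -/
noncomputable def tangentMap (M : Rep K A n) :
    tangentSpace (classify M) →ₗ[K] BimodDer K A (RepMod M) (RepMod M) where
  toFun D := ⟨(matrixEquiv M M).toLinearMap.comp
      ((LinearMap.mapMatrix D.1).comp (univRep K A n).toLinearMap), by
    rw [comp_matrixEquiv_mem_bimodDer_iff]
    intro a b
    ext i j
    simp only [LinearMap.comp_apply, AlgHom.toLinearMap_apply, map_mul, Matrix.mul_apply,
      LinearMap.mapMatrix_apply, Matrix.map_apply, map_sum, Matrix.add_apply]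
    rw [← Finset.sum_add_distrib]
    refine Finset.sum_congr rfl fun k _ => ?_
    rw [D.2, classify_univRep, classify_univRep, mul_comm (M b k j)]⟩
  map_add' D E := by
    refine Subtype.ext (LinearMap.ext fun a => (matrixEquiv M M).symm.injective ?_)
    ext i j
    simp
  map_smul' c D := by
    refine Subtype.ext (LinearMap.ext fun a => (matrixEquiv M M).symm.injective ?_)
    ext i j
    simp

/-- The derivation records a tangent vector only on the entries of the universal representation.
These determine an algebra homomorphism, which is why the tangent vector is replaced by its point
over the dual numbers. -/
theorem tangentMap_injective (M : Rep K A n) : Function.Injective (tangentMap M) := by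
  intro D E h
  have h1 (a : A) (i j : Fin n) : D.1 (univRep K A n a i j) = E.1 (univRep K A n a i j) := by
    have := congrArg (fun d => (matrixEquiv M M).symm (d.1 a) i j) h
    simpa [tangentMap] using this
  have h2 : tangentSpace.toDualNumber D = tangentSpace.toDualNumber E :=
    repRing_hom_ext fun a i j => by
      ext
      · rw [tangentSpace.toDualNumber_fst, tangentSpace.toDualNumber_fst]
      · rw [tangentSpace.toDualNumber_snd, tangentSpace.toDualNumber_snd, h1]
  refine Subtype.ext (LinearMap.ext fun x => ?_)
  rw [← tangentSpace.toDualNumber_snd, h2, tangentSpace.toDualNumber_snd]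

/-- The representation over the dual numbers attached to a derivation. -/
noncomputable def dualNumberRep (M : Rep K A n) (d : A →ₗ[K] Matrix (Fin n) (Fin n) K)
    (hd : ∀ a b, d (a * b) = M a * d b + d a * M b) :
    A →ₐ[K] Matrix (Fin n) (Fin n) (DualNumber K) :=
  AlgHom.ofLinearMap
    { toFun := fun a => Matrix.of fun i j => TrivSqZeroExt.inl (M a i j) + TrivSqZeroExt.inr (d a i j)
      map_add' := fun a b => by ext i j <;> simp
      map_smul' := fun c a => by ext i j <;> simp }
    (by
      have h1 : d 1 = 0 := by simpa using hd 1 1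
      ext i j <;> simp [h1, Matrix.one_apply, apply_ite])
    (fun a b => by
      ext i j
      · simp [Matrix.mul_apply, TrivSqZeroExt.fst_sum]
      · simp [Matrix.mul_apply, TrivSqZeroExt.snd_sum, hd, Finset.sum_add_distrib])

theorem dualNumberRep_fst (M : Rep K A n) (d : A →ₗ[K] Matrix (Fin n) (Fin n) K)
    (hd : ∀ a b, d (a * b) = M a * d b + d a * M b) (a : A) (i j : Fin n) :
    (dualNumberRep M d hd a i j).fst = M a i j := by simp [dualNumberRep]

theorem dualNumberRep_snd (M : Rep K A n) (d : A →ₗ[K] Matrix (Fin n) (Fin n) K)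
    (hd : ∀ a b, d (a * b) = M a * d b + d a * M b) (a : A) (i j : Fin n) :
    (dualNumberRep M d hd a i j).snd = d a i j := by simp [dualNumberRep]

/-- By the Leibniz rule `M + εd` is a representation over the dual numbers. The `ε`-part of its
classifying homomorphism is the required tangent vector. -/
theorem tangentMap_surjective (M : Rep K A n) : Function.Surjective (tangentMap M) := by
  rintro ⟨d, hd⟩
  obtain ⟨d, rfl⟩ : ∃ d', (matrixEquiv M M).toLinearMap.comp d' = d :=
    ⟨(matrixEquiv M M).symm.toLinearMap.comp d, by ext; simp⟩
  have hd' := (comp_matrixEquiv_mem_bimodDer_iff M M d).mp hd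
  let g := classify (dualNumberRep M d hd')
  have hg : (TrivSqZeroExt.fstHom K K K).comp g = classify M := repRing_hom_ext fun a i j => by
    rw [AlgHom.comp_apply, classify_univRep, classify_univRep]
    exact dualNumberRep_fst M d hd' a i j
  have hg (x : RepRing K A n) : (g x).fst = classify M x := congrArg (· x) hg
  refine ⟨⟨(TrivSqZeroExt.sndHom K K).restrictScalars K ∘ₗ g.toLinearMap, fun x y => ?_⟩, ?_⟩
  · simp [← hg, mul_comm]
  · refine Subtype.ext (LinearMap.ext fun a => (matrixEquiv M M).symm.injective ?_)
    ext i j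
    simp [tangentMap, g, classify_univRep, dualNumberRep_snd]

theorem finrank_tangentSpace_classify [Algebra.FiniteType K A] (M : Rep K A n) :
    (Module.finrank K (tangentSpace (classify M)) : ℤ) = (n : ℤ) ^ 2 - chi M M := by
  rw [sq, ← finrank_bimodDer,
    (LinearEquiv.ofBijective (tangentMap M) ⟨tangentMap_injective M,
      tangentMap_surjective M⟩).finrank_eq]

end Tangent
end NCRep

/-! ### Smooth connected components. -/

open TopologicalSpace in
theorem isClopen_connectedComponent_of_noetherianSpace {X : Type*} [TopologicalSpace X]
    [NoetherianSpace X] (x : X) : IsClopen (connectedComponent x) := by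
  refine ⟨isClosed_connectedComponent, ?_⟩
  have hfin : {Z ∈ irreducibleComponents X | Disjoint Z (connectedComponent x)}.Finite :=
    NoetherianSpace.finite_irreducibleComponents.subset fun _ h => h.1
  have hcl : IsClosed (⋃₀ {Z ∈ irreducibleComponents X | Disjoint Z (connectedComponent x)}) :=
    Set.sUnion_eq_biUnion ▸ hfin.isClosed_biUnion fun Z hZ => isClosed_of_mem_irreducibleComponents Z hZ.1
  -- Each irreducible component lies in a single connected component, so the complement is the union
  -- of the finitely many irreducible components disjoint from `connectedComponent x`.
  convert hcl.isOpen_compl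
  ext y
  constructor
  · rintro hy ⟨Z, ⟨-, hZ⟩, hyZ⟩
    exact Set.disjoint_left.mp hZ hyZ hy
  · intro hy
    by_contra hyx
    refine hy ⟨irreducibleComponent y, ⟨irreducibleComponent_mem_irreducibleComponents y, ?_⟩,
      mem_irreducibleComponent⟩
    have h1 : irreducibleComponent y ⊆ connectedComponent y :=
      isIrreducible_irreducibleComponent.isConnected.isPreconnected.subset_connectedComponent
        mem_irreducibleComponent
    refine Set.disjoint_of_subset_left h1 (connectedComponent_disjoint fun h => hyx ?_)
    rw [← h]
    exact mem_connectedComponent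

/-- A connected component of an affine scheme of finite type over a field, which is smooth, has as
dimension the dimension of the tangent space at each of its rational points. -/
theorem exists_dim_of_smooth_component {K R : Type u} [Field K] [CommRing R] [Algebra K R]
    [Algebra.FiniteType K R] (c : ConnectedComponents (PrimeSpectrum R))
    (hc : {p | ConnectedComponents.mk p = c} ⊆ Algebra.smoothLocus K R) :
    ∃ d : ℕ, topologicalKrullDim {p : PrimeSpectrum R | ConnectedComponents.mk p = c} = d ∧
      ∀ f : R →ₐ[K] K, ConnectedComponents.mk (PrimeSpectrum.comap f.toRingHom ⊥) = c →
        Module.finrank K (tangentSpace f) = d := by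
  have : IsNoetherianRing R := Algebra.FiniteType.isNoetherianRing K R
  have : Algebra.FinitePresentation K R := Algebra.FinitePresentation.of_finiteType.mp inferInstance
  obtain ⟨p, rfl⟩ := ConnectedComponents.surjective_coe c
  have hU : {q : PrimeSpectrum R | ConnectedComponents.mk q = ConnectedComponents.mk p} =
      connectedComponent p := by
    ext q
    rw [Set.mem_ofPred_eq, ConnectedComponents.coe_eq_coe']
  -- The clopen component is a basic open set, so it is the spectrum of the localization `S` of `R`
  -- at `e`.
  obtain ⟨e, -, he⟩ := PrimeSpectrum.exists_idempotent_basicOpen_eq_of_isClopen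
    (isClopen_connectedComponent_of_noetherianSpace p)
  have hUe := hU.trans he
  rw [hUe] at hc ⊢
  let S := Localization.Away e
  have : Algebra.Smooth K S := Algebra.basicOpen_subset_smoothLocus_iff_smooth.mp hc
  have hemb := PrimeSpectrum.localization_away_isOpenEmbedding S e
  have hrange := PrimeSpectrum.localization_away_comap_range S e
  have : PreconnectedSpace (PrimeSpectrum S) := by
    rw [preconnectedSpace_iff_univ, ← Set.preimage_range, hrange, ← he]
    exact isPreconnected_connectedComponent.preimage_of_isOpenMap hemb.injective hemb.isOpenMap
      (by rw [hrange, he])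
  obtain ⟨q, hq⟩ : p ∈ Set.range (PrimeSpectrum.comap (algebraMap R S)) := by
    rw [hrange, ← he]
    exact mem_connectedComponent
  have : Nontrivial S := PrimeSpectrum.nontrivial q
  let d := Module.rankAtStalk (R := S) Ω[S⁄K] q
  -- The rank of a finitely presented projective module is locally constant, and `Spec S` is
  -- connected.
  have hd (p : PrimeSpectrum S) : Module.rankAtStalk Ω[S⁄K] p = d := by
    have : Module.FinitePresentation S Ω[S⁄K] := Module.finitePresentation_of_projective S _
    exact (Module.isLocallyConstant_rankAtStalk (R := S)).apply_eq_of_preconnectedSpace _ _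
  refine ⟨d, ?_, fun f hf => ?_⟩
  · have hdim := PrimeSpectrum.topologicalKrullDim_eq_ringKrullDim S
    rw [Algebra.Smooth.ringKrullDim_eq d hd] at hdim
    rw [← hdim, ← hrange]
    exact (IsHomeomorph.topologicalKrullDim_eq _
      hemb.isEmbedding.toHomeomorph.isHomeomorph).symm
  · have hfe : f e ≠ 0 := by
      have : PrimeSpectrum.comap f.toRingHom ⊥ ∈ (PrimeSpectrum.basicOpen e : Set _) := by
        rw [← hUe]
        exact hf
      exact this
    -- A rational point in the component does not kill `e`, so it factors through `S`.
    let g : S →ₐ[K] K := IsLocalization.liftAlgHom (M := Submonoid.powers e) (f := f) (by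
      rintro ⟨_, k, rfl⟩
      simpa using fun h : f e = 0 => absurd h hfe)
    have hg : g.comp (IsScalarTower.toAlgHom K R S) = f := by
      ext x
      exact IsLocalization.lift_eq _ x
    have := Algebra.FormallyEtale.of_isLocalization (Rₘ := S) (Submonoid.powers e)
    rw [← hg, tangentSpace.finrank_eq_rankAtStalk_of_formallyEtale, hd]

/-! ### Smoothness for qurves. -/

namespace NCRep

section Qurve

variable {K A : Type u} [Field K] [Ring A] [Algebra K A]

/-- If `I² = 0`, the kernel of `M_n(C) → M_n(C/I)` consists of matrices with entries in `I` and also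
squares to zero. The qurve property lifts representations along this map, and the universal property
turns this into lifting of points. -/
theorem IsQurve.formallySmooth_repRing (hA : IsQurve K A) (n : ℕ) :
    Algebra.FormallySmooth K (RepRing K A n) := by
  refine Algebra.FormallySmooth.of_comp_surjective fun C _ _ I hI φ => ?_
  let π : Matrix (Fin n) (Fin n) C →ₐ[K] Matrix (Fin n) (Fin n) (C ⧸ I) :=
    (Ideal.Quotient.mkₐ K I).mapMatrix
  have hπ : Function.Surjective π := fun X => by
    choose f hf using fun i j => Ideal.Quotient.mk_surjective (X i j)
    exact ⟨Matrix.of f, by ext i j; exact hf i j⟩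
  have hker (X) (hX : X ∈ RingHom.ker π) (i j : Fin n) : X i j ∈ I :=
    Ideal.Quotient.eq_zero_iff_mem.mp (congrFun (congrFun hX i) j)
  have hnil : IsNilpotent (RingHom.ker π) := by
    refine ⟨2, ?_⟩
    rw [Submodule.pow_succ, Submodule.pow_one, Ideal.zero_eq_bot, eq_bot_iff, Ideal.mul_le]
    intro X hX Y hY
    ext i j
    rw [Matrix.mul_apply]
    refine Finset.sum_eq_zero fun k _ => ?_
    have := Ideal.mul_mem_mul (hker X hX i k) (hker Y hY k j)
    rwa [← sq, hI] at this
  let e := Ideal.quotientKerAlgEquivOfSurjective hπ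
  obtain ⟨g, hg⟩ := hA.exists_lift _ (RingHom.ker π) hnil
    (e.symm.toAlgHom.comp ((repEquiv n (C ⧸ I)).symm φ))
  refine ⟨classify g, (classify_comp (Ideal.Quotient.mkₐ K I) g).symm.trans ?_⟩
  have : π.comp g = (repEquiv n (C ⧸ I)).symm φ := by
    ext1 a
    have := congrArg e (congrArg (· a) hg)
    simpa [e] using this
  exact (congrArg classify this).trans ((repEquiv n (C ⧸ I)).apply_symm_apply φ)

theorem IsQurve.isSmooth (hA : IsQurve K A) (α : Comp K A) : α.IsSmooth := by
  have := hA.finiteType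
  have hs := hA.formallySmooth_repRing α.dim
  have : Algebra.FinitePresentation K (RepRing K A α.dim) :=
    Algebra.FinitePresentation.of_finiteType.mp inferInstance
  rw [Comp.IsSmooth, Algebra.smoothLocus_eq_univ_iff.mpr hs]
  exact Set.subset_univ _

end Qurve

/-! ### Constancy of the Euler form and the Tits form. -/

section Main

variable {K A : Type u} [Field K] [Ring A] [Algebra K A] [Algebra.FiniteType K A]

theorem Comp.IsSmooth.exists_dim {γ : Comp K A} (hγ : γ.IsSmooth) :
    ∃ d : ℕ, topologicalKrullDim γ.carrier = d ∧
      ∀ M : Rep K A γ.dim, γ.Mem M → (γ.dim : ℤ) ^ 2 - chi M M = d := by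
  obtain ⟨d, h1, h2⟩ := exists_dim_of_smooth_component γ.comp hγ
  refine ⟨d, h1, fun M hM => ?_⟩
  rw [← finrank_tangentSpace_classify, h2 (classify M)]
  have : PrimeSpectrum.comap (classify M).toRingHom ⊥ = Rep.point M := by
    ext x
    rfl
  rw [this]
  exact hM

theorem Comp.IsSmooth.chi_self_eq {γ : Comp K A} (hγ : γ.IsSmooth) {M M' : Rep K A γ.dim}
    (hM : γ.Mem M) (hM' : γ.Mem M') : chi M M = chi M' M' := by
  obtain ⟨d, -, h⟩ := hγ.exists_dim
  have h1 := h M hM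
  have h2 := h M' hM'
  linarith

/-- Polarization: `χ(M ⊕ N, M ⊕ N) = χ(M, M) + χ(N, N) + χ(M, N) + χ(N, M)`, where the left side and
the first two terms on the right are constant by smoothness of the three components. -/
theorem chi_add_chi_eq [IsAlgClosed K] {α β : Comp K A} (hα : α.IsSmooth) (hβ : β.IsSmooth)
    (hαβ : (α + β).IsSmooth) {M M' : Rep K A α.dim} {N N' : Rep K A β.dim} (hM : α.Mem M)
    (hM' : α.Mem M') (hN : β.Mem N) (hN' : β.Mem N') :
    chi M N + chi N M = chi M' N' + chi N' M' := by
  have h1 := hα.chi_self_eq hM hM'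
  have h2 := hβ.chi_self_eq hN hN'
  have h3 := hαβ.chi_self_eq (Comp.dirSum_mem_add hM hN) (Comp.dirSum_mem_add hM' hN')
  simp only [chi_dirSum_left, chi_dirSum_right] at h3
  linarith

end Main
end NCRep

end

theorem mainTheorem7 {K A : Type u} [Field K] [IsAlgClosed K] [Ring A] [Algebra K A]
    [Algebra.FiniteType K A] :
    -- `Hom` and `Ext^1` are finite dimensional, so that `χ` is defined
    (∀ (n m : ℕ) (M : NCRep.Rep K A n) (N : NCRep.Rep K A m),
      Module.Finite K (NCRep.HomA M N) ∧ Module.Finite K (NCRep.ExtA M N)) ∧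
    -- dimension formula
    (∀ γ : NCRep.Comp K A, γ.IsSmooth →
      (∃ d : ℕ, topologicalKrullDim γ.carrier = d ∧
        ∀ M : NCRep.Rep K A γ.dim, γ.Mem M → (γ.dim : ℤ) ^ 2 - NCRep.chi M M = d) ∧
      ∀ M M' : NCRep.Rep K A γ.dim, γ.Mem M → γ.Mem M' → NCRep.chi M M = NCRep.chi M' M') ∧
    -- the symmetrized form is constant
    (∀ α β : NCRep.Comp K A, α.IsSmooth → β.IsSmooth → (α + β).IsSmooth →
      ∃ c : ℤ, ∀ (M : NCRep.Rep K A α.dim) (N : NCRep.Rep K A β.dim), α.Mem M → β.Mem N →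
        NCRep.chi M N + NCRep.chi N M = c) ∧
    -- the Tits form of a qurve
    (NCRep.IsQurve K A →
      (∀ α : NCRep.Comp K A, α.IsSmooth) ∧
      ∃ T : NCRep.Comp K A → NCRep.Comp K A → ℤ,
        (∀ (α β : NCRep.Comp K A) (M : NCRep.Rep K A α.dim) (N : NCRep.Rep K A β.dim),
          α.Mem M → β.Mem N → T α β = NCRep.chi M N + NCRep.chi N M) ∧
        (∀ α β, T α β = T β α) ∧
        (∀ α β δ, T (α + β) δ = T α δ + T β δ) ∧
        (∀ α β δ, T α (β + δ) = T α β + T α δ)) := by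
  refine ⟨fun n m M N => ⟨inferInstance, inferInstance⟩,
    fun γ hγ => ⟨hγ.exists_dim, fun M M' => hγ.chi_self_eq⟩, fun α β hα hβ hαβ => ?_,
    fun hA => ⟨hA.isSmooth, ?_⟩⟩
  · obtain ⟨M, hM⟩ := α.exists_mem
    obtain ⟨N, hN⟩ := β.exists_mem
    exact ⟨NCRep.chi M N + NCRep.chi N M, fun M' N' hM' hN' =>
      NCRep.chi_add_chi_eq hα hβ hαβ hM' hM hN' hN⟩
  · choose P hP using fun α : NCRep.Comp K A => α.exists_mem
    -- The form is defined through chosen points `P α`; its value does not depend on them.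
    have key (α β : NCRep.Comp K A) (M : NCRep.Rep K A α.dim) (N : NCRep.Rep K A β.dim)
        (hM : α.Mem M) (hN : β.Mem N) :
        NCRep.chi (P α) (P β) + NCRep.chi (P β) (P α) = NCRep.chi M N + NCRep.chi N M :=
      NCRep.chi_add_chi_eq (hA.isSmooth α) (hA.isSmooth β) (hA.isSmooth _) (hP α) hM (hP β) hN
    refine ⟨fun α β => NCRep.chi (P α) (P β) + NCRep.chi (P β) (P α), key,
      fun α β => add_comm _ _, fun α β δ => ?_, fun α β δ => ?_⟩
    -- The chosen point of `α + β` need not be `P α ⊕ P β`, but that direct sum lies in the same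
    -- component and may replace it.
    · refine (key _ _ _ _ (NCRep.Comp.dirSum_mem_add (hP α) (hP β)) (hP δ)).trans ?_
      rw [NCRep.chi_dirSum_left, NCRep.chi_dirSum_right]
      ring
    · refine (key _ _ _ _ (hP α) (NCRep.Comp.dirSum_mem_add (hP β) (hP δ))).trans ?_
      rw [NCRep.chi_dirSum_left, NCRep.chi_dirSum_right]
      ring
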